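/- There are absolute constants $C_1,C_2\in\mathbb N$ such that the following holds. Let $\mathbb F=\mathbb R$ or $\mathbb C$, let $n\ge 1$ and let $M\in\mathbb F^{n\times n}$. Suppose that the map $v\mapsto Mv$ is computed by a linear arithmetic circuit with $s$ gates (the $n$ input gates included) and depth $d$. Then $$M\in(\mathcal{OBB})^{w}_{e}\quad\text{for some } w\le C_1\max(d,1)\text{ and } e\le C_2\,\frac{s}{n},$$ that is, $M\in(\mathcal{OBB})^{O(d)}_{O(s/n)}$ (with $O(1)$ in place of $O(d)$ if $d=0$). Here a linear arithmetic circuit is an acyclic circuit each of whose non-input gates has two inputs $x,y$, each an input gate or another non-input gate, and computes $ax+by$ for fixed constants $a,b\in\mathbb F$; the $n$ outputs are designated gates; the depth is the least number of layers into which the non-input gates can be arranged so that each gate takes its inputs only from input gates and gates in earlier layers. For $N\ge2$ a power of two, an orthogonal butterfly factor of size $N$ is an orthogonal (over $\mathbb C$: unitary) matrix $\begin{bmatrix}D_1&D_2\\D_3&D_4\end{bmatrix}$ with diagonal $\frac N2\times\frac N2$ blocks $D_i$. The only orthogonal butterfly matrix of size $1$ is the identity, and an orthogonal butterfly matrix of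 size $N\ge 2$ is a product of an orthogonal butterfly factor of size $N$ with a matrix $\begin{bmatrix}B_1&0\\0&B_2\end{bmatrix}$, where $B_1,B_2$ are orthogonal butterfly matrices of size $\frac N2$. A matrix is in $\mathcal{OBB}$ if it has the form $O_1DO_2^*$ with $O_1,O_2$ orthogonal butterfly matrices and $D$ diagonal (possibly singular), and in $(\mathcal{OBB})^w$ if it is a product of $w$ matrices in $\mathcal{OBB}$ of the same size. An $n\times n$ matrix $M$ is in $(\mathcal{OBB})^w_e$ if $en\ge n$ is a power of two and $M$ is the upper-left $n\times n$ corner of some $en\times en$ matrix in $(\mathcal{OBB})^w$ (so $e$ is a power of two if $n$ is; for other $n$ the rational number $e$ includes the padding to a power of two). -/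

import Mathlib

namespace Kaleidoscope

/-! ### Linear arithmetic circuits -/

/-- A linear arithmetic circuit over `𝕜` with `n` input gates, `m` outputs and `gates` internal
gates. A node of the circuit is an input gate (`Sum.inl i`) or an internal gate (`Sum.inr j`).
The internal gate `j` has the two inputs `left j`, `right j` and computes
`a j * (left j) + b j * (right j)`, with fixed constants `a j`, `b j`. The circuit is acyclic: the
internal gates are listed in an order in which each gate only uses earlier ones.
The outputs are designated nodes of the circuit. -/
structure LinearCircuit (𝕜 : Type*) (n m : ℕ) where
  gates : ℕ
  a : Fin gates → 𝕜
  b : Fin gates → 𝕜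
  left : Fin gates → Fin n ⊕ Fin gates
  right : Fin gates → Fin n ⊕ Fin gates
  left_lt : ∀ {j i : Fin gates}, left j = Sum.inr i → i < j
  right_lt : ∀ {j i : Fin gates}, right j = Sum.inr i → i < j
  out : Fin m → Fin n ⊕ Fin gates

namespace LinearCircuit

/-- The size of a circuit: the number of all its gates, the input gates included. -/
def size {𝕜 : Type*} {n m : ℕ} (C : LinearCircuit 𝕜 n m) : ℕ := n + C.gates

/-- `layer` arranges the internal gates into the layers `1, …, d`, such that all the gates of a
layer take as inputs only nodes of previous layers (the input gates form layer `0`, which does not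
count). -/
def IsLayering {𝕜 : Type*} {n m : ℕ} (C : LinearCircuit 𝕜 n m) (d : ℕ)
    (layer : Fin C.gates → ℕ) : Prop :=
  ∀ j : Fin C.gates, 1 ≤ layer j ∧ layer j ≤ d ∧
    (∀ i, C.left j = Sum.inr i → layer i < layer j) ∧
    (∀ i, C.right j = Sum.inr i → layer i < layer j)

/-- The depth of a circuit: the minimum number of layers. -/
noncomputable def depth {𝕜 : Type*} {n m : ℕ} (C : LinearCircuit 𝕜 n m) : ℕ :=
  sInf {d : ℕ | ∃ layer : Fin C.gates → ℕ, C.IsLayering d layer}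

/-- The minimum in the definition of the depth is attained. -/
theorem exists_isLayering_depth {𝕜 : Type*} {n m : ℕ} (C : LinearCircuit 𝕜 n m) :
    ∃ layer : Fin C.gates → ℕ, C.IsLayering C.depth layer := by
  have h : {d : ℕ | ∃ layer : Fin C.gates → ℕ, C.IsLayering d layer}.Nonempty := by
    refine ⟨C.gates, fun j => j.val + 1, fun j => ⟨Nat.le_add_left 1 j.val, j.isLt, ?_, ?_⟩⟩
    · intro i hi
      have := C.left_lt hi
      simpa using this
    · intro i hi
      have := C.right_lt hi
      simpa using this
  exact Nat.sInf_mem h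

/-- The value of the internal gate `j` when the inputs are `x`. -/
def gateValue {𝕜 : Type*} [Semiring 𝕜] {n m : ℕ} (C : LinearCircuit 𝕜 n m) (x : Fin n → 𝕜)
    (j : Fin C.gates) : 𝕜 :=
  C.a j * (match _h : C.left j with
    | Sum.inl i => x i
    | Sum.inr i => C.gateValue x i) +
  C.b j * (match _h : C.right j with
    | Sum.inl i => x i
    | Sum.inr i => C.gateValue x i)
termination_by j.val
decreasing_by
  · exact C.left_lt _h
  · exact C.right_lt _h

/-- The value of a node of the circuit when the inputs are `x`. -/
def nodeValue {𝕜 : Type*} [Semiring 𝕜] {n m : ℕ} (C : LinearCircuit 𝕜 n m) (x : Fin n → 𝕜) :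
    Fin n ⊕ Fin C.gates → 𝕜 :=
  Sum.elim x (C.gateValue x)

theorem gateValue_eq {𝕜 : Type*} [Semiring 𝕜] {n m : ℕ} (C : LinearCircuit 𝕜 n m)
    (x : Fin n → 𝕜) (j : Fin C.gates) :
    C.gateValue x j =
      C.a j * C.nodeValue x (C.left j) + C.b j * C.nodeValue x (C.right j) := by
  rw [gateValue]
  congr 2
  · split <;> rename_i h <;> simp [nodeValue, h]
  · split <;> rename_i h <;> simp [nodeValue, h]

/-- The circuit represents the multiplication of `M` times an arbitrary vector. -/
def Computes {𝕜 : Type*} [Semiring 𝕜] {n m : ℕ} (C : LinearCircuit 𝕜 n m)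
    (M : Matrix (Fin m) (Fin n) 𝕜) : Prop :=
  ∀ (x : Fin n → 𝕜) (i : Fin m), C.nodeValue x (C.out i) = M.mulVec x i

end LinearCircuit

/-! ### Orthogonal butterfly matrices -/

/-- The first half of the indices `0, …, 2 ^ (k + 1) - 1`, followed by the second half. -/
def halves (k : ℕ) : Fin (2 ^ k) ⊕ Fin (2 ^ k) ≃ Fin (2 ^ (k + 1)) :=
  finSumFinEquiv.trans (finCongr (by rw [pow_succ]; omega))

/-- The matrix of size `2 ^ (k + 1)` with the given four blocks of size `2 ^ k`. -/
def ofBlocks {𝕜 : Type*} {k : ℕ} (A B C D : Matrix (Fin (2 ^ k)) (Fin (2 ^ k)) 𝕜) :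
    Matrix (Fin (2 ^ (k + 1))) (Fin (2 ^ (k + 1))) 𝕜 :=
  Matrix.reindex (halves k) (halves k) (Matrix.fromBlocks A B C D)

/-- Butterfly factors of size `2 ^ (k + 1)`: all four blocks are diagonal. -/
def IsButterflyFactor {𝕜 : Type*} [RCLike 𝕜] {k : ℕ}
    (F : Matrix (Fin (2 ^ (k + 1))) (Fin (2 ^ (k + 1))) 𝕜) : Prop :=
  ∃ d₁ d₂ d₃ d₄ : Fin (2 ^ k) → 𝕜,
    F = ofBlocks (Matrix.diagonal d₁) (Matrix.diagonal d₂)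
      (Matrix.diagonal d₃) (Matrix.diagonal d₄)

/-- Orthogonal (over `ℂ`: unitary) butterfly factors of size `2 ^ (k + 1)`. -/
def IsOrthButterflyFactor {𝕜 : Type*} [RCLike 𝕜] {k : ℕ}
    (F : Matrix (Fin (2 ^ (k + 1))) (Fin (2 ^ (k + 1))) 𝕜) : Prop :=
  IsButterflyFactor F ∧ F ∈ Matrix.unitaryGroup (Fin (2 ^ (k + 1))) 𝕜

/-- Orthogonal butterfly matrices of size `2 ^ k`. For `k = 0` this is the empty product of
butterfly factors; in size `2 ^ (k + 1)` it is an orthogonal butterfly factor of full size times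
a block diagonal matrix of two (possibly different) orthogonal butterfly matrices of half the
size. -/
def IsOrthButterfly {𝕜 : Type*} [RCLike 𝕜] :
    (k : ℕ) → Matrix (Fin (2 ^ k)) (Fin (2 ^ k)) 𝕜 → Prop
  | 0, M => M = 1
  | k + 1, M => ∃ (F : Matrix (Fin (2 ^ (k + 1))) (Fin (2 ^ (k + 1))) 𝕜)
      (M₁ M₂ : Matrix (Fin (2 ^ k)) (Fin (2 ^ k)) 𝕜),
      IsOrthButterflyFactor F ∧ IsOrthButterfly k M₁ ∧ IsOrthButterfly k M₂ ∧
        M = F * ofBlocks M₁ 0 0 M₂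

/-! ### The orthogonal kaleidoscope hierarchy -/

/-- The class `OBB` in size `2 ^ k`: products of an orthogonal butterfly matrix, a diagonal matrix
(which may be singular), and the (conjugate) transpose of an orthogonal butterfly matrix. -/
def IsOBB {𝕜 : Type*} [RCLike 𝕜] {k : ℕ} (M : Matrix (Fin (2 ^ k)) (Fin (2 ^ k)) 𝕜) : Prop :=
  ∃ (O₁ O₂ : Matrix (Fin (2 ^ k)) (Fin (2 ^ k)) 𝕜) (d : Fin (2 ^ k) → 𝕜),
    IsOrthButterfly k O₁ ∧ IsOrthButterfly k O₂ ∧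
      M = O₁ * Matrix.diagonal d * O₂.conjTranspose

/-- The class `(OBB)^w` in size `2 ^ k`: products of `w` matrices in `OBB`. -/
def IsOBBPow {𝕜 : Type*} [RCLike 𝕜] {k : ℕ} (w : ℕ)
    (M : Matrix (Fin (2 ^ k)) (Fin (2 ^ k)) 𝕜) : Prop :=
  ∃ L : List (Matrix (Fin (2 ^ k)) (Fin (2 ^ k)) 𝕜),
    L.length = w ∧ (∀ A ∈ L, IsOBB A) ∧ M = L.prod

/-- The class `(OBB)^w_e`: `n × n` matrices `M` that are the upper left corner of some
`en × en` matrix `E` in `(OBB)^w`. Here `en = 2 ^ k` is a power of two, because butterfly matrices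
only exist in these sizes. If `n` is a power of two, then `e` is a natural number; for other `n`,
the fractional `e` accounts for the padding to a power of two. -/
def InOBBHierarchy {𝕜 : Type*} [RCLike 𝕜] {n : ℕ} (w : ℕ) (e : ℚ)
    (M : Matrix (Fin n) (Fin n) 𝕜) : Prop :=
  ∃ (k : ℕ) (h : n ≤ 2 ^ k) (E : Matrix (Fin (2 ^ k)) (Fin (2 ^ k)) 𝕜),
    e * (n : ℚ) = (2 : ℚ) ^ k ∧ IsOBBPow w E ∧
      M = E.submatrix (Fin.castLE h) (Fin.castLE h)

end Kaleidoscope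

namespace Kaleidoscope

/-! ### Block matrices -/

section Blocks

/-! Store all nodes of the circuit in a memory of `2 ^ k` cells, where `2 ^ k` is `s` rounded up to
a power of two. Evaluating one layer is then a linear map with at most two nonzero entries per row,
`diagonal a * gather l + diagonal b * gather r`, in which finished cells copy themselves. It
suffices to put each such map into a bounded power of OBB; doubling the size to `2 ^ (k + 1)` gives
the room for this.

In the doubled size, one gather fetches the left inputs into the first half and the right inputs
into the second. A single diagonal matrix times a transposed butterfly factor then combines the
halves (`isOBB_ofBlocks_diagonal`).

An arbitrary gather is a permutation times a monotone gather, by sorting. Permutations are in OBB by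
the recursive Beneš network: the two sides of `O₁ * O₂.conjTranspose` are its two halves
(`gather_perm_eq`). A monotone gather copies values onto intervals. `exists_isOrthButterfly_support`
builds an orthogonal butterfly matrix in which each interval is exactly the support of some row; its
conjugate transpose broadcasts along the intervals, and a diagonal matrix normalizes the nonzero
entries to 1. -/

theorem halves_inl_val {k : ℕ} (i : Fin (2 ^ k)) : (halves k (Sum.inl i)).val = i.val := by
  simp [halves]

theorem halves_inr_val {k : ℕ} (i : Fin (2 ^ k)) :
    (halves k (Sum.inr i)).val = 2 ^ k + i.val := by
  simp [halves, add_comm]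

theorem ofBlocks_apply {𝕜 : Type*} {k : ℕ} (A B C D : Matrix (Fin (2 ^ k)) (Fin (2 ^ k)) 𝕜)
    (x y : Fin (2 ^ k) ⊕ Fin (2 ^ k)) :
    ofBlocks A B C D (halves k x) (halves k y) = Matrix.fromBlocks A B C D x y := by
  simp [ofBlocks]

variable {𝕜 : Type*} [RCLike 𝕜] {k : ℕ}

theorem ofBlocks_mul (A B C D A' B' C' D' : Matrix (Fin (2 ^ k)) (Fin (2 ^ k)) 𝕜) :
    ofBlocks A B C D * ofBlocks A' B' C' D' =
      ofBlocks (A * A' + B * C') (A * B' + B * D') (C * A' + D * C') (C * B' + D * D') := by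
  simp [ofBlocks, Matrix.submatrix_mul_equiv, Matrix.fromBlocks_multiply]

theorem conjTranspose_ofBlocks (A B C D : Matrix (Fin (2 ^ k)) (Fin (2 ^ k)) 𝕜) :
    (ofBlocks A B C D).conjTranspose =
      ofBlocks A.conjTranspose C.conjTranspose B.conjTranspose D.conjTranspose := by
  simp [ofBlocks, Matrix.fromBlocks_conjTranspose]

theorem ofBlocks_one : ofBlocks (1 : Matrix (Fin (2 ^ k)) (Fin (2 ^ k)) 𝕜) 0 0 1 = 1 := by
  simp [ofBlocks]

theorem ofBlocks_diagonal (d₁ d₂ : Fin (2 ^ k) → 𝕜) :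
    ofBlocks (Matrix.diagonal d₁) 0 0 (Matrix.diagonal d₂) =
      Matrix.diagonal (Sum.elim d₁ d₂ ∘ (halves k).symm) := by
  simp [ofBlocks, Matrix.fromBlocks_diagonal, Matrix.submatrix_diagonal_equiv]

end Blocks

/-! ### Orthogonal butterfly matrices -/

section Butterfly

variable {𝕜 : Type*} [RCLike 𝕜] {k : ℕ}

theorem isOrthButterflyFactor_ofBlocks {d₁ d₂ d₃ d₄ : Fin (2 ^ k) → 𝕜}
    (h₁ : ∀ i, star (d₁ i) * d₁ i + star (d₃ i) * d₃ i = 1)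
    (h₂ : ∀ i, star (d₂ i) * d₂ i + star (d₄ i) * d₄ i = 1)
    (h₃ : ∀ i, star (d₁ i) * d₂ i + star (d₃ i) * d₄ i = 0) :
    IsOrthButterflyFactor (ofBlocks (Matrix.diagonal d₁) (Matrix.diagonal d₂)
      (Matrix.diagonal d₃) (Matrix.diagonal d₄)) := by
  refine ⟨⟨d₁, d₂, d₃, d₄, rfl⟩, ?_⟩
  have h₄ : ∀ i, star (d₂ i) * d₁ i + star (d₄ i) * d₃ i = 0 := fun i => by
    have := congrArg star (h₃ i)
    simpa [mul_comm] using this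
  rw [Matrix.mem_unitaryGroup_iff', Matrix.star_eq_conjTranspose, conjTranspose_ofBlocks,
    ofBlocks_mul]
  simp only [Matrix.diagonal_conjTranspose, Matrix.diagonal_mul_diagonal, Matrix.diagonal_add,
    Pi.star_apply, h₁, h₂, h₃, h₄]
  simpa using ofBlocks_one

theorem isOrthButterflyFactor_one :
    IsOrthButterflyFactor (1 : Matrix (Fin (2 ^ (k + 1))) (Fin (2 ^ (k + 1))) 𝕜) := by
  rw [← ofBlocks_one, ← Matrix.diagonal_one, ← Matrix.diagonal_zero]
  exact isOrthButterflyFactor_ofBlocks (by simp) (by simp) (by simp)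

theorem isOrthButterfly_one :
    ∀ k : ℕ, IsOrthButterfly k (1 : Matrix (Fin (2 ^ k)) (Fin (2 ^ k)) 𝕜)
  | 0 => rfl
  | k + 1 => ⟨1, 1, 1, isOrthButterflyFactor_one, isOrthButterfly_one k, isOrthButterfly_one k,
      by rw [ofBlocks_one, one_mul]⟩

theorem IsOrthButterflyFactor.isOrthButterfly
    {F : Matrix (Fin (2 ^ (k + 1))) (Fin (2 ^ (k + 1))) 𝕜} (hF : IsOrthButterflyFactor F) :
    IsOrthButterfly (k + 1) F :=
  ⟨F, 1, 1, hF, isOrthButterfly_one k, isOrthButterfly_one k, by rw [ofBlocks_one, mul_one]⟩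

/-- The permutation matrix that exchanges the two halves. -/
def swapHalves (𝕜 : Type*) [RCLike 𝕜] (k : ℕ) :
    Matrix (Fin (2 ^ (k + 1))) (Fin (2 ^ (k + 1))) 𝕜 :=
  ofBlocks 0 1 1 0

theorem swapHalves_mul_apply (O : Matrix (Fin (2 ^ (k + 1))) (Fin (2 ^ (k + 1))) 𝕜)
    (x : Fin (2 ^ k) ⊕ Fin (2 ^ k)) (j : Fin (2 ^ (k + 1))) :
    (swapHalves 𝕜 k * O) (halves k x) j = O (halves k x.swap) j := by
  rw [Matrix.mul_apply, ← (halves k).sum_comp]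
  cases x <;> simp [swapHalves, ofBlocks_apply, Matrix.one_apply]

theorem IsOrthButterfly.swapHalves_mul {O : Matrix (Fin (2 ^ (k + 1))) (Fin (2 ^ (k + 1))) 𝕜}
    (hO : IsOrthButterfly (k + 1) O) : IsOrthButterfly (k + 1) (swapHalves 𝕜 k * O) := by
  obtain ⟨F, M₁, M₂, ⟨⟨d₁, d₂, d₃, d₄, rfl⟩, hF⟩, h₁, h₂, rfl⟩ := hO
  refine ⟨_, M₁, M₂, ⟨⟨d₃, d₄, d₁, d₂, ?_⟩, ?_⟩, h₁, h₂, (mul_assoc _ _ _).symm⟩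
  · simp [swapHalves, ofBlocks_mul]
  · refine mul_mem ?_ hF
    rw [Matrix.mem_unitaryGroup_iff', Matrix.star_eq_conjTranspose, swapHalves,
      conjTranspose_ofBlocks, ofBlocks_mul]
    simpa using ofBlocks_one

end Butterfly

/-! ### Copying along an orthogonal butterfly matrix -/

section Copy

/-- If the rotations of a butterfly factor are nontrivial exactly at the positions in `S`, the
support of the product with a block diagonal matrix is as expected. -/
theorem exists_factor_rotating (𝕜 : Type*) [RCLike 𝕜] {k : ℕ} (S : Set (Fin (2 ^ k))) :
    ∃ F : Matrix (Fin (2 ^ (k + 1))) (Fin (2 ^ (k + 1))) 𝕜, IsOrthButterflyFactor F ∧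
      ∀ (O₁ O₂ : Matrix (Fin (2 ^ k)) (Fin (2 ^ k)) 𝕜) (q j : Fin (2 ^ k)),
        ((F * ofBlocks O₁ 0 0 O₂) (halves k (.inl q)) (halves k (.inl j)) ≠ 0 ↔ O₁ q j ≠ 0) ∧
        ((F * ofBlocks O₁ 0 0 O₂) (halves k (.inl q)) (halves k (.inr j)) ≠ 0 ↔
          q ∈ S ∧ O₂ q j ≠ 0) ∧
        ((F * ofBlocks O₁ 0 0 O₂) (halves k (.inr q)) (halves k (.inl j)) ≠ 0 ↔
          q ∈ S ∧ O₁ q j ≠ 0) ∧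
        ((F * ofBlocks O₁ 0 0 O₂) (halves k (.inr q)) (halves k (.inr j)) ≠ 0 ↔
          O₂ q j ≠ 0) := by
  classical
  -- Any rotation without zero entries would do; (3/5, 4/5) is a rational one. The two halves of a
  -- row involve disjoint sets of columns, so nothing can cancel.
  refine ⟨ofBlocks (Matrix.diagonal fun i => if i ∈ S then 3 / 5 else 1)
    (Matrix.diagonal fun i => if i ∈ S then 4 / 5 else 0)
    (Matrix.diagonal fun i => if i ∈ S then - (4 / 5) else 0)
    (Matrix.diagonal fun i => if i ∈ S then 3 / 5 else 1), ?_, ?_⟩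
  · refine isOrthButterflyFactor_ofBlocks ?_ ?_ ?_ <;> intro i <;> by_cases h : i ∈ S <;>
      simp [h] <;> norm_num
  · intro O₁ O₂ q j
    rw [ofBlocks_mul]
    simp only [ofBlocks_apply]
    by_cases h : q ∈ S <;> simp [h]

/-- Since `g` is monotone, at most one label occurs in both halves. If that label sits at the same
position in both recursive matrices, rotating at this one position merges its two rows. To align
them, the induction needs the freedom to prescribe the position of one label, hence `m` and `q`. -/
theorem exists_isOrthButterfly_support (𝕜 : Type*) [RCLike 𝕜] {ι : Type*} [LinearOrder ι] :
    ∀ (k : ℕ) (g : Fin (2 ^ k) → ι), Monotone g → ∀ m q : Fin (2 ^ k),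
      ∃ (p : Fin (2 ^ k) → Fin (2 ^ k)) (O : Matrix (Fin (2 ^ k)) (Fin (2 ^ k)) 𝕜),
        IsOrthButterfly k O ∧ p m = q ∧ (∀ i j, g i = g j → p i = p j) ∧
          ∀ i j, O (p i) j ≠ 0 ↔ g i = g j := by
  intro k
  induction k with
  | zero =>
    intro g _ m q
    have hs : ∀ i j : Fin (2 ^ 0), i = j := fun i j => Subsingleton.elim (α := Fin 1) i j
    refine ⟨id, 1, rfl, hs _ _, fun i j _ => hs _ _, fun i j => ?_⟩
    obtain rfl := hs i j
    exact iff_of_true (ne_of_eq_of_ne (Matrix.one_apply_eq i) one_ne_zero) rfl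
  | succ k ih =>
    intro g hg m q
    set g₁ : Fin (2 ^ k) → ι := fun i => g (halves k (.inl i)) with hg₁
    set g₂ : Fin (2 ^ k) → ι := fun i => g (halves k (.inr i)) with hg₂
    have mono₁ : Monotone g₁ := fun i j hij => hg (by
      rw [Fin.le_def, halves_inl_val, halves_inl_val]; exact hij)
    have mono₂ : Monotone g₂ := fun i j hij => hg (by
      rw [Fin.le_def, halves_inr_val, halves_inr_val]; exact Nat.add_le_add_left hij _)
    have hle : ∀ i j, g₁ i ≤ g₂ j := fun i j => hg (by
      rw [Fin.le_def, halves_inl_val, halves_inr_val]; omega)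
    -- A label common to both halves is the maximum of the first and the minimum of the second,
    -- hence unique.
    have huniq : ∀ a b a' b', g₁ a = g₂ b → g₁ a' = g₂ b' → g₁ a = g₁ a' := by
      intro a b a' b' h h'
      exact le_antisymm ((hle a b').trans h'.ge) ((hle a' b).trans h.ge)
    -- it suffices to reach the right pair of positions
    suffices H : ∃ (p : Fin (2 ^ (k + 1)) → Fin (2 ^ (k + 1)))
        (O : Matrix (Fin (2 ^ (k + 1))) (Fin (2 ^ (k + 1))) 𝕜),
        IsOrthButterfly (k + 1) O ∧
        (p m = q ∨ p m = halves k ((halves k).symm q).swap) ∧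
        (∀ i j, g i = g j → p i = p j) ∧ ∀ i j, O (p i) j ≠ 0 ↔ g i = g j by
      obtain ⟨p, O, hO, hq | hq, hp, hs⟩ := H
      · exact ⟨p, O, hO, hq, hp, hs⟩
      · refine ⟨fun i => halves k ((halves k).symm (p i)).swap, swapHalves 𝕜 k * O,
          hO.swapHalves_mul, by simp [hq], fun i j h => by simp [hp i j h], fun i j => ?_⟩
        rw [swapHalves_mul_apply]
        simpa using hs i j
    -- arrange the two halves such that a common label sits at the same position
    have key : ∃ (p₁ p₂ : Fin (2 ^ k) → Fin (2 ^ k)) (O₁ O₂ : Matrix (Fin (2 ^ k)) (Fin (2 ^ k)) 𝕜),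
        IsOrthButterfly k O₁ ∧ IsOrthButterfly k O₂ ∧
        (∀ i j, g₁ i = g₁ j → p₁ i = p₁ j) ∧ (∀ i j, g₂ i = g₂ j → p₂ i = p₂ j) ∧
        (∀ i j, O₁ (p₁ i) j ≠ 0 ↔ g₁ i = g₁ j) ∧ (∀ i j, O₂ (p₂ i) j ≠ 0 ↔ g₂ i = g₂ j) ∧
        (∀ i j, g₁ i = g₂ j → p₁ i = p₂ j) ∧
        Sum.elim p₁ p₂ ((halves k).symm m) = Sum.elim id id ((halves k).symm q) := by
      -- The half containing `m` spends its free choice on the position of `m`; the other half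
      -- spends its own on matching the position of the common label.
      rcases (halves k).symm m with m' | m'
      · obtain ⟨p₁, O₁, hO₁, hm, hp₁, hs₁⟩ := ih g₁ mono₁ m' (Sum.elim id id ((halves k).symm q))
        by_cases hsh : ∃ a b, g₁ a = g₂ b
        · obtain ⟨a, b, hab⟩ := hsh
          obtain ⟨p₂, O₂, hO₂, hm₂, hp₂, hs₂⟩ := ih g₂ mono₂ b (p₁ a)
          refine ⟨p₁, p₂, O₁, O₂, hO₁, hO₂, hp₁, hp₂, hs₁, hs₂, fun i j hij => ?_, hm⟩
          have := huniq _ _ _ _ hij hab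
          rw [hp₁ i a this, ← hm₂]
          exact hp₂ _ _ (by rw [← hab, ← this, hij])
        · obtain ⟨p₂, O₂, hO₂, hm₂, hp₂, hs₂⟩ := ih g₂ mono₂ m' m'
          exact ⟨p₁, p₂, O₁, O₂, hO₁, hO₂, hp₁, hp₂, hs₁, hs₂,
            fun i j hij => (hsh ⟨i, j, hij⟩).elim, hm⟩
      · obtain ⟨p₂, O₂, hO₂, hm, hp₂, hs₂⟩ := ih g₂ mono₂ m' (Sum.elim id id ((halves k).symm q))
        by_cases hsh : ∃ a b, g₁ a = g₂ b
        · obtain ⟨a, b, hab⟩ := hsh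
          obtain ⟨p₁, O₁, hO₁, hm₁, hp₁, hs₁⟩ := ih g₁ mono₁ a (p₂ b)
          refine ⟨p₁, p₂, O₁, O₂, hO₁, hO₂, hp₁, hp₂, hs₁, hs₂, fun i j hij => ?_, hm⟩
          have := huniq _ _ _ _ hij hab
          rw [hp₁ i a this, hm₁]
          exact hp₂ _ _ (by rw [← hab, ← this, hij])
        · obtain ⟨p₁, O₁, hO₁, hm₁, hp₁, hs₁⟩ := ih g₁ mono₁ m' m'
          exact ⟨p₁, p₂, O₁, O₂, hO₁, hO₂, hp₁, hp₂, hs₁, hs₂,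
            fun i j hij => (hsh ⟨i, j, hij⟩).elim, hm⟩
    obtain ⟨p₁, p₂, O₁, O₂, hO₁, hO₂, hp₁, hp₂, hs₁, hs₂, hsh, hm⟩ := key
    obtain ⟨F, hF, hFs⟩ := exists_factor_rotating 𝕜 {q | ∃ a b, g₁ a = g₂ b ∧ p₁ a = q}
    classical
    have hsupp₁ : ∀ a x, (F * ofBlocks O₁ 0 0 O₂) (halves k (.inl (p₁ a))) (halves k x) ≠ 0 ↔
        g₁ a = g (halves k x) := by
      rintro a (j | j)
      · rw [(hFs O₁ O₂ _ _).1, hs₁]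
      · rw [(hFs O₁ O₂ _ _).2.1]
        constructor
        · rintro ⟨⟨a₀, b₀, hab, hpa⟩, hne⟩
          have h1 : g₁ a₀ = g₁ a := by
            rw [← hs₁, hpa, hs₁]
          rw [← hpa, hsh _ _ hab, hs₂] at hne
          rw [← h1, hab, hne]
        · intro h
          exact ⟨⟨a, j, h, rfl⟩, by rw [hsh a j h, hs₂]⟩
    have hsupp₂ : ∀ b, (¬ ∃ a, g₁ a = g₂ b) → ∀ x,
        (F * ofBlocks O₁ 0 0 O₂) (halves k (.inr (p₂ b))) (halves k x) ≠ 0 ↔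
        g₂ b = g (halves k x) := by
      rintro b hb (j | j)
      · rw [(hFs O₁ O₂ _ _).2.2.1]
        constructor
        · rintro ⟨⟨a₀, b₀, hab, hpa⟩, -⟩
          refine (hb ⟨a₀, ?_⟩).elim
          rw [hab, ← hs₂, ← hsh _ _ hab, hpa, hs₂]
        · exact fun h => (hb ⟨j, h.symm⟩).elim
      · rw [(hFs O₁ O₂ _ _).2.2.2, hs₂]
    -- Rotation gives the common label two full rows, one in each half; the one in the first half is
    -- chosen.
    let P : Fin (2 ^ k) ⊕ Fin (2 ^ k) → Fin (2 ^ k) ⊕ Fin (2 ^ k) :=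
      Sum.elim (fun a => .inl (p₁ a))
        (fun b => if ∃ a, g₁ a = g₂ b then .inl (p₂ b) else .inr (p₂ b))
    have hsupp : ∀ x y, (F * ofBlocks O₁ 0 0 O₂) (halves k (P x)) (halves k y) ≠ 0 ↔
        g (halves k x) = g (halves k y) := by
      rintro (a | b) y
      · exact hsupp₁ a y
      · by_cases hb : ∃ a, g₁ a = g₂ b
        · obtain ⟨a, hab⟩ := hb
          have hP : P (.inr b) = .inl (p₁ a) := by
            simp only [P, Sum.elim_inr]
            rw [if_pos ⟨a, hab⟩, hsh a b hab]
          rw [hP, hsupp₁, hab]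
        · have hP : P (.inr b) = .inr (p₂ b) := by simp only [P, Sum.elim_inr]; rw [if_neg hb]
          rw [hP, hsupp₂ b hb]
    have hPeq : ∀ x y, g (halves k x) = g (halves k y) → P x = P y := by
      have hlr : ∀ a b, g₁ a = g₂ b → P (.inl a) = P (.inr b) := by
        intro a b h
        simp only [P, Sum.elim_inl, Sum.elim_inr]
        rw [if_pos ⟨a, h⟩, hsh a b h]
      rintro (a | a) (b | b) h
      · exact congrArg Sum.inl (hp₁ a b h)
      · exact hlr a b h
      · exact (hlr b a h.symm).symm
      · have h' : g₂ a = g₂ b := h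
        simp only [P, Sum.elim_inr, h', hp₂ a b h']
    refine ⟨fun i => halves k (P ((halves k).symm i)), F * ofBlocks O₁ 0 0 O₂,
      ⟨F, O₁, O₂, hF, hO₁, hO₂, rfl⟩, ?_, fun i j h => ?_, fun i j => ?_⟩
    · have hswap : ∀ x y : Fin (2 ^ k) ⊕ Fin (2 ^ k),
          Sum.elim id id x = Sum.elim id id y → x = y ∨ x = y.swap := by
        rintro (x | x) (y | y) h <;> simp_all
      have hP : Sum.elim id id (P ((halves k).symm m)) = Sum.elim id id ((halves k).symm q) := by
        rw [← hm]
        rcases (halves k).symm m with a | b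
        · rfl
        · simp only [P, Sum.elim_inr]; split_ifs <;> rfl
      rcases hswap _ _ hP with h | h
      · left; simp only [h, Equiv.apply_symm_apply]
      · right; simp only [h]
    · exact congrArg (halves k) (hPeq _ _ (by simpa using h))
    · simpa using hsupp ((halves k).symm i) ((halves k).symm j)

end Copy

/-! ### Routing of permutations -/

section Coloring

/-- Two fixed point free involutions have a common 2-colouring. -/
theorem exists_coloring_of_involutive {X : Type*} (τ ρ : Equiv.Perm X)
    (hτ : ∀ x, τ (τ x) = x) (hρ : ∀ x, ρ (ρ x) = x) (hτ' : ∀ x, τ x ≠ x) (hρ' : ∀ x, ρ x ≠ x) :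
    ∃ χ : X → Bool, (∀ x, χ (τ x) = !χ x) ∧ ∀ x, χ (ρ x) = !χ x := by
  classical
  set c : Equiv.Perm X := τ * ρ with hc
  have hτi : τ⁻¹ = τ := by ext x; rw [Equiv.Perm.inv_eq_iff_eq, hτ]
  have hρi : ρ⁻¹ = ρ := by ext x; rw [Equiv.Perm.inv_eq_iff_eq, hρ]
  have hττ : τ * τ = 1 := by ext x; simp [hτ]
  have hρρ : ρ * ρ = 1 := by ext x; simp [hρ]
  -- The two involutions generate a dihedral group in which both invert `c`, so both act on the set
  -- of `c`-cycles.
  have hconjτ : ∀ m : ℤ, τ * c ^ m = c ^ (-m) * τ := by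
    intro m
    have h : τ * c * τ⁻¹ = c⁻¹ := by rw [hc, mul_inv_rev, hτi, hρi, ← mul_assoc, hττ, one_mul]
    have h2 := conj_zpow (i := m) (a := τ) (b := c)
    rw [h, inv_zpow', eq_mul_inv_iff_mul_eq] at h2
    exact h2.symm
  have hconjρ : ∀ m : ℤ, ρ * c ^ m = c ^ (-m) * ρ := by
    intro m
    have h : ρ * c * ρ⁻¹ = c⁻¹ := by rw [hc, mul_inv_rev, hτi, hρi, mul_assoc, mul_assoc, hρρ,
      mul_one]
    have h2 := conj_zpow (i := m) (a := ρ) (b := c)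
    rw [h, inv_zpow', eq_mul_inv_iff_mul_eq] at h2
    exact h2.symm
  -- If `τ x = c ^ m x`, then `c ^ l x` with `m = 2 * l` or `m = 2 * l + 1` is a fixed point of `τ`
  -- or of `ρ`, respectively.
  have hne : ∀ x, ¬ c.SameCycle x (τ x) := by
    rintro x ⟨m, hm⟩
    obtain ⟨l, rfl | rfl⟩ := Int.even_or_odd' m
    · apply hτ' ((c ^ l) x)
      have := congrArg (c ^ (-l)) hm
      rw [← Equiv.Perm.mul_apply, ← zpow_add, ← Equiv.Perm.mul_apply, ← hconjτ,
        Equiv.Perm.mul_apply] at this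
      rw [← this]
      congr 2
      ring
    · apply hρ' ((c ^ l) x)
      have h1 : ρ x = (c ^ (2 * l)) x := by
        rw [add_comm, zpow_one_add, Equiv.Perm.mul_apply, hc, Equiv.Perm.mul_apply, ← hc] at hm
        exact (congrArg ρ (τ.injective hm)).symm.trans (hρ _)
      have := congrArg (c ^ (-l)) h1
      rw [← Equiv.Perm.mul_apply, ← hconjρ,
        ← Equiv.Perm.mul_apply (c ^ (-l)), ← zpow_add, Equiv.Perm.mul_apply] at this
      rw [this]
      congr 2
      ring
  let S : Setoid X := Equiv.Perm.SameCycle.setoid c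
  let t : Quotient S → Quotient S := Quotient.map τ (by
    rintro x y ⟨m, hm⟩
    refine ⟨-m, ?_⟩
    rw [← Equiv.Perm.mul_apply, ← hconjτ, Equiv.Perm.mul_apply, hm])
  have ht : ∀ x, t ⟦x⟧ = ⟦τ x⟧ := fun x => rfl
  have htt : ∀ q, t (t q) = q := by
    rintro ⟨x⟩
    exact congrArg (Quotient.mk S) (hτ x)
  have htne : ∀ q, t q ≠ q := by
    rintro ⟨x⟩ h
    exact hne x (Quotient.exact h).symm
  -- `τ` pairs up the cycles; a well-order picks one cycle of each pair.
  let χ : Quotient S → Bool := fun q => decide (WellOrderingRel q (t q))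
  have hχ : ∀ q, χ (t q) = !χ q := by
    intro q
    simp only [χ, htt]
    rcases trichotomous_of WellOrderingRel q (t q) with h | h | h
    · simp [h, asymm_of WellOrderingRel h]
    · exact (htne q h.symm).elim
    · simp [h, asymm_of WellOrderingRel h]
  refine ⟨fun x => χ ⟦x⟧, fun x => hχ ⟦x⟧, fun x => ?_⟩
  -- `c (ρ x) = τ x`, so `ρ` and `τ` act alike on cycles.
  have : (⟦ρ x⟧ : Quotient S) = t ⟦x⟧ := by
    rw [ht]
    apply Quotient.sound
    refine ⟨1, ?_⟩
    rw [zpow_one, hc, Equiv.Perm.mul_apply, hρ]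
  simp only [this, hχ]

variable {α : Type*}

/-- Exchange the two copies of those elements that are selected by `δ`. -/
def condSwap (δ : α → Bool) : Equiv.Perm (α ⊕ α) :=
  Function.Involutive.toPerm (fun x => if δ (Sum.elim id id x) then x.swap else x) (by
    rintro (x | x) <;> by_cases h : δ x <;> simp [h])

theorem condSwap_apply (δ : α → Bool) (x : α ⊕ α) :
    condSwap δ x = if δ (Sum.elim id id x) then x.swap else x := rfl

theorem condSwap_condSwap (δ : α → Bool) (x : α ⊕ α) : condSwap δ (condSwap δ x) = x :=
  (condSwap δ).symm_apply_apply x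

/-- The two copies of an element have opposite colours, so the switch can send each to the half
named by its colour. -/
theorem isRight_condSwap {χ : α ⊕ α → Bool} (hχ : ∀ x, χ x.swap = !χ x) (x : α ⊕ α) :
    (condSwap (fun j => χ (.inl j)) x).isRight = χ x := by
  rcases x with j | j
  · cases h : χ (.inl j) <;> simp [condSwap_apply, h]
  · have := hχ (.inl j)
    rw [Sum.swap_inl] at this
    cases h : χ (.inl j) <;> simp [condSwap_apply, h, this]

/-- One level of the Beneš network. -/
theorem exists_condSwap_decomposition [Finite α] (σ : Equiv.Perm (α ⊕ α)) :
    ∃ (δ ε : α → Bool) (σ₁ σ₂ : Equiv.Perm α),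
      ∀ x, σ x = condSwap ε (Sum.map σ₁ σ₂ (condSwap δ x)) := by
  -- The colour of `x` is the half through which `x` is routed: elements paired at the input, or
  -- whose images are paired at the output, must take different halves.
  obtain ⟨χ, h₁, h₂⟩ := exists_coloring_of_involutive (Equiv.sumComm α α)
    ((σ.trans (Equiv.sumComm α α)).trans σ.symm) (by simp) (by simp)
    (by rintro (x | x) <;> simp) (by
      intro x h
      have h' : (σ x).swap = σ x := by simpa [Equiv.symm_apply_eq] using h
      rcases hx : σ x with y | y <;> simp [hx] at h')
  have h₁' : ∀ x : α ⊕ α, χ x.swap = !χ x := fun x => by simpa using h₁ x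
  have h₂' : ∀ y : α ⊕ α, χ (σ.symm y.swap) = !χ (σ.symm y) := fun y => by
    simpa using h₂ (σ.symm y)
  set δ : α → Bool := fun j => χ (.inl j)
  set ε : α → Bool := fun j => χ (σ.symm (.inl j))
  have hδ := isRight_condSwap h₁'
  have hε := isRight_condSwap (χ := fun y => χ (σ.symm y)) h₂'
  have hmem : condSwap ε * σ * condSwap δ ∈ (Equiv.Perm.sumCongrHom α α).range := by
    apply Equiv.Perm.mem_sumCongrHom_range_of_perm_mapsTo_inl
    rintro _ ⟨j, rfl⟩
    have h3 := hδ (condSwap δ (.inl j))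
    rw [condSwap_condSwap] at h3
    have h4 := hε (σ (condSwap δ (.inl j)))
    rw [σ.symm_apply_apply, ← h3] at h4
    simp only [Equiv.Perm.mul_apply]
    rcases hx : condSwap ε (σ (condSwap δ (.inl j))) with y | y
    · exact ⟨y, rfl⟩
    · rw [hx] at h4
      simp at h4
  obtain ⟨⟨σ₁, σ₂⟩, hσ⟩ := hmem
  refine ⟨δ, ε, σ₁, σ₂, fun x => ?_⟩
  have h5 := congrArg (fun f => condSwap ε (f (condSwap δ x))) hσ
  simp only [Equiv.Perm.mul_apply, condSwap_condSwap] at h5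
  rw [← h5]
  rfl

end Coloring

/-! ### Gathering -/

section Gather

/-- The matrix of `x ↦ x ∘ f`. -/
def gather (𝕜 : Type*) [RCLike 𝕜] {ι κ : Type*} [DecidableEq κ] (f : ι → κ) : Matrix ι κ 𝕜 :=
  fun i j => if f i = j then 1 else 0

variable {𝕜 : Type*} [RCLike 𝕜]

theorem gather_apply {ι κ : Type*} [DecidableEq κ] (f : ι → κ) (i : ι) (j : κ) :
    gather 𝕜 f i j = if f i = j then 1 else 0 := rfl

theorem gather_mul {ι κ l : Type*} [Fintype κ] [DecidableEq κ] (f : ι → κ)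
    (A : Matrix κ l 𝕜) : gather 𝕜 f * A = fun i j => A (f i) j := by
  ext i j
  simp [Matrix.mul_apply, gather_apply]

theorem gather_mul_gather {ι κ l : Type*} [Fintype κ] [DecidableEq κ] [DecidableEq l]
    (f : ι → κ) (g : κ → l) : gather 𝕜 f * gather 𝕜 g = gather 𝕜 (g ∘ f) := gather_mul _ _

theorem gather_mulVec {ι κ : Type*} [Fintype κ] [DecidableEq κ] (f : ι → κ) (v : κ → 𝕜) (i : ι) :
    (gather 𝕜 f).mulVec v i = v (f i) := by
  simp [Matrix.mulVec, dotProduct, gather_apply]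

variable {k : ℕ}

theorem gather_condSwap (δ : Fin (2 ^ k) → Bool) :
    gather 𝕜 (fun i => halves k (condSwap δ ((halves k).symm i))) =
      ofBlocks (Matrix.diagonal fun i => if δ i then 0 else 1)
        (Matrix.diagonal fun i => if δ i then 1 else 0)
        (Matrix.diagonal fun i => if δ i then 1 else 0)
        (Matrix.diagonal fun i => if δ i then 0 else 1) := by
  ext i j
  obtain ⟨x, rfl⟩ := (halves k).surjective i
  obtain ⟨y, rfl⟩ := (halves k).surjective j
  rw [ofBlocks_apply]
  simp only [gather_apply, Equiv.symm_apply_apply, EmbeddingLike.apply_eq_iff_eq, condSwap_apply]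
  rcases x with x | x <;> rcases y with y | y <;> by_cases h : δ x <;>
    simp [h, Matrix.diagonal_apply]

theorem isOrthButterflyFactor_gather_condSwap (δ : Fin (2 ^ k) → Bool) :
    IsOrthButterflyFactor
      (gather 𝕜 (fun i => halves k (condSwap δ ((halves k).symm i)))) := by
  rw [gather_condSwap]
  refine isOrthButterflyFactor_ofBlocks ?_ ?_ ?_ <;> intro i <;> by_cases h : δ i <;> simp [h]

theorem conjTranspose_gather_condSwap (δ : Fin (2 ^ k) → Bool) :
    (gather 𝕜 (fun i => halves k (condSwap δ ((halves k).symm i)))).conjTranspose =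
      gather 𝕜 (fun i => halves k (condSwap δ ((halves k).symm i))) := by
  rw [gather_condSwap, conjTranspose_ofBlocks]
  simp only [Matrix.diagonal_conjTranspose]
  congr <;> ext i <;> by_cases h : δ i <;> simp [h]

theorem gather_sumMap (f₁ f₂ : Fin (2 ^ k) → Fin (2 ^ k)) :
    gather 𝕜 (fun i => halves k (Sum.map f₁ f₂ ((halves k).symm i))) =
      ofBlocks (gather 𝕜 f₁) 0 0 (gather 𝕜 f₂) := by
  ext i j
  obtain ⟨x, rfl⟩ := (halves k).surjective i
  obtain ⟨y, rfl⟩ := (halves k).surjective j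
  rw [ofBlocks_apply]
  simp only [gather_apply, Equiv.symm_apply_apply, EmbeddingLike.apply_eq_iff_eq]
  rcases x with x | x <;> rcases y with y | y <;> simp [gather_apply]

/-- Permutation matrices are routed by an orthogonal butterfly matrix followed by a transposed
one. -/
theorem gather_perm_eq (𝕜 : Type*) [RCLike 𝕜] : ∀ (k : ℕ) (σ : Equiv.Perm (Fin (2 ^ k))),
    ∃ O₁ O₂ : Matrix (Fin (2 ^ k)) (Fin (2 ^ k)) 𝕜,
      IsOrthButterfly k O₁ ∧ IsOrthButterfly k O₂ ∧ gather 𝕜 σ = O₁ * O₂.conjTranspose := by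
  intro k
  induction k with
  | zero =>
    intro σ
    refine ⟨1, 1, rfl, rfl, ?_⟩
    rw [Matrix.conjTranspose_one, mul_one]
    ext i j
    have hs : ∀ i j : Fin (2 ^ 0), i = j := fun i j => Subsingleton.elim (α := Fin 1) i j
    rw [gather_apply, if_pos (hs _ _), hs i j, Matrix.one_apply_eq]
  | succ k ih =>
    intro σ
    obtain ⟨δ, ε, σ₁, σ₂, h⟩ :=
      exists_condSwap_decomposition (((halves k).trans σ).trans (halves k).symm)
    obtain ⟨A₁, B₁, hA₁, hB₁, h₁⟩ := ih σ₁
    obtain ⟨A₂, B₂, hA₂, hB₂, h₂⟩ := ih σ₂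
    refine ⟨_, _, ⟨_, A₁, A₂, isOrthButterflyFactor_gather_condSwap δ, hA₁, hA₂, rfl⟩,
      ⟨_, B₁, B₂, isOrthButterflyFactor_gather_condSwap ε, hB₁, hB₂, rfl⟩, ?_⟩
    -- `gather` reverses composition, so the input switches `δ` become the left factor; the
    -- symmetric output switches `ε` are absorbed into the transposed butterfly matrix.
    have hσ : (σ : Fin (2 ^ (k + 1)) → Fin (2 ^ (k + 1))) =
        ((fun i => halves k (condSwap ε ((halves k).symm i))) ∘
          fun i => halves k (Sum.map σ₁ σ₂ ((halves k).symm i))) ∘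
          fun i => halves k (condSwap δ ((halves k).symm i)) := by
      funext i
      have := h ((halves k).symm i)
      simp only [Equiv.trans_apply, Equiv.apply_symm_apply] at this
      simp [← this]
    rw [hσ, ← gather_mul_gather, ← gather_mul_gather, gather_sumMap, h₁, h₂,
      Matrix.conjTranspose_mul, conjTranspose_gather_condSwap, conjTranspose_ofBlocks]
    simp only [Matrix.conjTranspose_zero]
    have : ofBlocks (A₁ * B₁.conjTranspose) 0 0 (A₂ * B₂.conjTranspose) =
        ofBlocks A₁ 0 0 A₂ * ofBlocks B₁.conjTranspose 0 0 B₂.conjTranspose := by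
      simp [ofBlocks_mul]
    rw [this]
    simp only [mul_assoc]

end Gather

/-! ### Sparse matrices in the orthogonal kaleidoscope hierarchy -/

section OBB

variable {𝕜 : Type*} [RCLike 𝕜] {k : ℕ}

theorem IsOBB.isOBBPow {A : Matrix (Fin (2 ^ k)) (Fin (2 ^ k)) 𝕜} (h : IsOBB A) :
    IsOBBPow 1 A :=
  ⟨[A], rfl, by simpa using h, by simp⟩

theorem IsOBBPow.mul {v w : ℕ} {A B : Matrix (Fin (2 ^ k)) (Fin (2 ^ k)) 𝕜}
    (hA : IsOBBPow v A) (hB : IsOBBPow w B) : IsOBBPow (v + w) (A * B) := by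
  obtain ⟨L, rfl, hL, rfl⟩ := hA
  obtain ⟨L', rfl, hL', rfl⟩ := hB
  refine ⟨L ++ L', List.length_append, fun A hA => ?_, List.prod_append.symm⟩
  rcases List.mem_append.1 hA with h | h
  exacts [hL A h, hL' A h]

theorem isOBB_diagonal_mul_conjTranspose (d : Fin (2 ^ k) → 𝕜)
    {O : Matrix (Fin (2 ^ k)) (Fin (2 ^ k)) 𝕜} (hO : IsOrthButterfly k O) :
    IsOBB (Matrix.diagonal d * O.conjTranspose) :=
  ⟨1, O, d, isOrthButterfly_one k, hO, by rw [one_mul]⟩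

theorem isOBB_diagonal (d : Fin (2 ^ k) → 𝕜) : IsOBB (Matrix.diagonal d) :=
  ⟨1, 1, d, isOrthButterfly_one k, isOrthButterfly_one k, by simp⟩

theorem isOBB_gather_perm (σ : Equiv.Perm (Fin (2 ^ k))) : IsOBB (gather 𝕜 σ) := by
  obtain ⟨O₁, O₂, h₁, h₂, h⟩ := gather_perm_eq 𝕜 k σ
  exact ⟨O₁, O₂, fun _ => 1, h₁, h₂, by rw [h, Matrix.diagonal_one, mul_one]⟩

theorem exists_perm_extending {α β : Type*} [Finite α] (p g : β → α)
    (h : ∀ i j, p i = p j ↔ g i = g j) : ∃ τ : Equiv.Perm α, ∀ j, τ (p j) = g j := by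
  classical
  have := Fintype.ofFinite α
  let f : α → α := Function.extend p g id
  have hf : ∀ j, f (p j) = g j := fun j =>
    Function.FactorsThrough.extend_apply (fun i j hij => (h i j).1 hij) _ j
  obtain ⟨e, he⟩ := Finset.exists_equiv_extend_of_card_eq (t := (Finset.univ : Finset α))
    (s := (Set.range p).toFinset) (f := f) (by simp) (Finset.subset_univ _) (by
      intro x hx y hy hxy
      simp only [Set.coe_toFinset, Set.mem_range] at hx hy
      obtain ⟨i, rfl⟩ := hx
      obtain ⟨j, rfl⟩ := hy
      rw [hf, hf] at hxy
      exact (h i j).2 hxy)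
  refine ⟨e.trans (Equiv.subtypeUnivEquiv (by simp)), fun j => ?_⟩
  rw [← hf]
  exact he (p j) (by simp)

theorem isOBBPow_gather_of_monotone {g : Fin (2 ^ k) → Fin (2 ^ k)} (hg : Monotone g) :
    IsOBBPow 3 (gather 𝕜 g) := by
  classical
  have h0 : 0 < 2 ^ k := Nat.two_pow_pos k
  -- The prescribed position matters only inside the induction; any choice serves here.
  obtain ⟨p, O, hO, -, hp, hs⟩ := exists_isOrthButterfly_support 𝕜 k g hg ⟨0, h0⟩ ⟨0, h0⟩
  have hpg : ∀ i j, p i = p j ↔ g i = g j := fun i j =>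
    ⟨fun h => by rw [← hs, h, hs], hp i j⟩
  obtain ⟨τ, hτ⟩ := exists_perm_extending p g hpg
  -- Read from the right: `τ` brings entry `g j` to position `p j`, the mask clears positions
  -- outside the range of `p`, `O.conjTranspose` spreads each entry over its fibre of `g`, and the
  -- left diagonal rescales the coefficients to 1.
  have key : gather 𝕜 g = Matrix.diagonal (fun j => (star (O (p j) j))⁻¹) * O.conjTranspose *
      Matrix.diagonal (fun q => if q ∈ Set.range p then 1 else 0) * gather 𝕜 τ := by
    ext j i
    obtain ⟨q, rfl⟩ := τ.surjective i
    simp only [Matrix.mul_apply (N := gather 𝕜 τ), Matrix.mul_diagonal, Matrix.diagonal_mul,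
      gather_apply, EmbeddingLike.apply_eq_iff_eq, mul_ite, mul_one, mul_zero,
      Finset.sum_ite_eq', Finset.mem_univ, if_true, Matrix.conjTranspose_apply]
    by_cases hq : q ∈ Set.range p
    · obtain ⟨j', rfl⟩ := hq
      rw [if_pos (Set.mem_range_self j'), hτ]
      by_cases h : g j = g j'
      · have hne : star (O (p j') j) ≠ 0 := star_ne_zero.2 ((hs j' j).2 h.symm)
        rw [if_pos h, hp j j' h, inv_mul_cancel₀ hne]
      · have h0 : O (p j') j = 0 := by
          by_contra hne
          exact h ((hs j' j).1 hne).symm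
        rw [if_neg h, h0, star_zero, mul_zero]
    · rw [if_neg hq, if_neg]
      intro h
      rw [← hτ] at h
      exact hq ⟨j, τ.injective h⟩
  rw [key]
  exact ((isOBB_diagonal_mul_conjTranspose _ hO).isOBBPow.mul (isOBB_diagonal _).isOBBPow).mul
    (isOBB_gather_perm τ).isOBBPow

/-- Sorting the values of `f` costs one permutation and leaves a monotone gather: 1 + 3 factors. -/
theorem isOBBPow_gather (f : Fin (2 ^ k) → Fin (2 ^ k)) : IsOBBPow 4 (gather 𝕜 f) := by
  have h : f = (f ∘ Tuple.sort f) ∘ (Tuple.sort f).symm := by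
    funext i
    simp
  rw [h, ← gather_mul_gather]
  exact (isOBB_gather_perm (Tuple.sort f).symm).isOBBPow.mul
    (isOBBPow_gather_of_monotone (Tuple.monotone_sort f))

theorem exists_polar (a b : 𝕜) :
    ∃ r u v : 𝕜, a = r * u ∧ b = r * v ∧ u * star u + v * star v = 1 := by
  by_cases h : a = 0 ∧ b = 0
  -- With `r = 0` any unit vector works.
  · exact ⟨0, 1, 0, by simp [h.1], by simp [h.2], by simp⟩
  have hpos : 0 < ‖a‖ ^ 2 + ‖b‖ ^ 2 := by
    rcases not_and_or.1 h with h | h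
    · have := norm_pos_iff.2 h; positivity
    · have := norm_pos_iff.2 h; positivity
  set r : ℝ := Real.sqrt (‖a‖ ^ 2 + ‖b‖ ^ 2) with hr
  have hrpos : 0 < r := Real.sqrt_pos.2 hpos
  have hr0 : (r : 𝕜) ≠ 0 := RCLike.ofReal_ne_zero.2 hrpos.ne'
  refine ⟨r, a / r, b / r, by field_simp, by field_simp, ?_⟩
  have hsq : r ^ 2 = ‖a‖ ^ 2 + ‖b‖ ^ 2 := Real.sq_sqrt hpos.le
  have hsq' : (r : 𝕜) ^ 2 = (‖a‖ : 𝕜) ^ 2 + (‖b‖ : 𝕜) ^ 2 := by exact_mod_cast hsq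
  have ha : a * star a = (‖a‖ : 𝕜) ^ 2 := RCLike.mul_conj a
  have hb : b * star b = (‖b‖ : 𝕜) ^ 2 := RCLike.mul_conj b
  rw [star_div₀, star_div₀, RCLike.star_def, RCLike.conj_ofReal, div_mul_div_comm,
    div_mul_div_comm, ← RCLike.star_def, ha, hb, ← add_div, ← hsq', ← pow_two, div_self]
  exact pow_ne_zero 2 hr0

theorem isOBB_ofBlocks_diagonal (a b : Fin (2 ^ k) → 𝕜) :
    IsOBB (ofBlocks (Matrix.diagonal a) (Matrix.diagonal b) 0 0) := by
  choose r u v ha hb huv using fun i => exists_polar (a i) (b i)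
  -- The unit row `(u, v)` is completed to a unitary 2 × 2 matrix, written here as its adjoint. The
  -- scaling `Sum.elim r 0` then erases the unwanted second row.
  have hF : IsOrthButterflyFactor (ofBlocks (Matrix.diagonal fun i => star (u i))
      (Matrix.diagonal fun i => - v i) (Matrix.diagonal fun i => star (v i))
      (Matrix.diagonal u)) := by
    refine isOrthButterflyFactor_ofBlocks (fun i => ?_) (fun i => ?_) (fun i => ?_)
    · rw [star_star, star_star, huv]
    · rw [← huv i, star_neg]; ring
    · rw [star_star, star_star]; ring
  have key : ofBlocks (Matrix.diagonal a) (Matrix.diagonal b) 0 0 =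
      Matrix.diagonal (Sum.elim r 0 ∘ (halves k).symm) * (ofBlocks
      (Matrix.diagonal fun i => star (u i)) (Matrix.diagonal fun i => - v i)
      (Matrix.diagonal fun i => star (v i)) (Matrix.diagonal u)).conjTranspose := by
    rw [← ofBlocks_diagonal, conjTranspose_ofBlocks, ofBlocks_mul]
    simp only [Matrix.diagonal_conjTranspose, Matrix.diagonal_mul_diagonal, zero_mul, add_zero,
      Pi.zero_apply, Matrix.diagonal_zero, Pi.star_apply, star_star]
    simp only [← ha, ← hb]
  rw [key]
  exact isOBB_diagonal_mul_conjTranspose _ hF.isOrthButterfly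

/-- The second half of the memory serves as scratch space for the right operands. The gather costs 4
factors and the linear combination 1. -/
theorem isOBBPow_ofBlocks_sparse (a b : Fin (2 ^ k) → 𝕜) (l r : Fin (2 ^ k) → Fin (2 ^ k)) :
    IsOBBPow 5 (ofBlocks (Matrix.diagonal a * gather 𝕜 l + Matrix.diagonal b * gather 𝕜 r)
      0 0 0) := by
  have h : ofBlocks (Matrix.diagonal a * gather 𝕜 l + Matrix.diagonal b * gather 𝕜 r) 0 0 0 =
      ofBlocks (Matrix.diagonal a) (Matrix.diagonal b) 0 0 *
        gather 𝕜 (fun i => halves k (Sum.inl (Sum.elim l r ((halves k).symm i)))) := by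
    have hg : gather 𝕜 (fun i => halves k (Sum.inl (Sum.elim l r ((halves k).symm i)))) =
        ofBlocks (gather 𝕜 l) 0 (gather 𝕜 r) 0 := by
      ext i j
      obtain ⟨x, rfl⟩ := (halves k).surjective i
      obtain ⟨y, rfl⟩ := (halves k).surjective j
      rw [ofBlocks_apply]
      simp only [gather_apply, Equiv.symm_apply_apply, EmbeddingLike.apply_eq_iff_eq]
      rcases x with x | x <;> rcases y with y | y <;> simp [gather_apply]
    rw [hg, ofBlocks_mul]
    simp
  rw [h]
  exact (isOBB_ofBlocks_diagonal a b).isOBBPow.mul (isOBBPow_gather _)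

theorem sparse_mulVec (a b : Fin (2 ^ k) → 𝕜) (l r : Fin (2 ^ k) → Fin (2 ^ k))
    (v : Fin (2 ^ k) → 𝕜) (i : Fin (2 ^ k)) :
    (Matrix.diagonal a * gather 𝕜 l + Matrix.diagonal b * gather 𝕜 r).mulVec v i =
      a i * v (l i) + b i * v (r i) := by
  rw [Matrix.add_mulVec, Pi.add_apply, ← Matrix.mulVec_mulVec, ← Matrix.mulVec_mulVec,
    Matrix.mulVec_diagonal, Matrix.mulVec_diagonal, gather_mulVec, gather_mulVec]

theorem IsOBBPow.ofBlocks_mul_corner {v w : ℕ} {A B : Matrix (Fin (2 ^ k)) (Fin (2 ^ k)) 𝕜}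
    (hA : IsOBBPow v (ofBlocks A 0 0 0)) (hB : IsOBBPow w (ofBlocks B 0 0 0)) :
    IsOBBPow (v + w) (ofBlocks (A * B) 0 0 0) := by
  have := hA.mul hB
  rw [ofBlocks_mul] at this
  simpa using this

end OBB

/-! ### Circuits -/

section Circuit

variable {𝕜 : Type*} [RCLike 𝕜] {n m k : ℕ}

/-- Evaluation of the layers `1, …, t` of a circuit, where the node `x` is stored at the
position `pos x`. -/
theorem LinearCircuit.exists_isOBBPow_layers (C : LinearCircuit 𝕜 n m) {d : ℕ}
    {layer : Fin C.gates → ℕ} (hl : C.IsLayering d layer)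
    (pos : Fin n ⊕ Fin C.gates → Fin (2 ^ k)) (hpos : Function.Injective pos) (t : ℕ) :
    ∃ A : Matrix (Fin (2 ^ k)) (Fin (2 ^ k)) 𝕜, IsOBBPow (5 * (t + 1)) (ofBlocks A 0 0 0) ∧
      ∀ (x : Fin n → 𝕜) (v : Fin (2 ^ k) → 𝕜), (∀ i, v (pos (.inl i)) = x i) →
        (∀ i, A.mulVec v (pos (.inl i)) = x i) ∧
        ∀ j, layer j ≤ t → A.mulVec v (pos (.inr j)) = C.gateValue x j := by
  induction t with
  | zero =>
    -- The induction starts from the corner identity, which costs the extra 5 factors. No gate has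
    -- layer 0, so the claim about gates is vacuous.
    refine ⟨_, isOBBPow_ofBlocks_sparse (fun _ => 1) (fun _ => 0) id id, fun x v hv =>
      ⟨fun i => ?_, fun j hj => ?_⟩⟩
    · rw [sparse_mulVec, one_mul, zero_mul, add_zero]
      exact hv i
    · exact absurd hj (by have := (hl j).1; omega)
  | succ t ih =>
    obtain ⟨A, hA, hAv⟩ := ih
    -- Only gates of layer `t + 1` are computed; every other node keeps its value. Cells holding no
    -- node are irrelevant, so the defaults are arbitrary.
    let a := Function.extend pos
      (Sum.elim (fun _ => 1) fun j => if layer j = t + 1 then C.a j else 1) 0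
    let b := Function.extend pos
      (Sum.elim (fun _ => 0) fun j => if layer j = t + 1 then C.b j else 0) 0
    let l := Function.extend pos (Sum.elim (fun i => pos (.inl i))
      fun j => if layer j = t + 1 then pos (C.left j) else pos (.inr j)) id
    let r := Function.extend pos (Sum.elim (fun i => pos (.inl i))
      fun j => if layer j = t + 1 then pos (C.right j) else pos (.inr j)) id
    refine ⟨_, by
      have := (isOBBPow_ofBlocks_sparse a b l r).ofBlocks_mul_corner hA
      rwa [show 5 * (t + 1 + 1) = 5 + 5 * (t + 1) by ring], fun x v hv => ?_⟩
    obtain ⟨h₁, h₂⟩ := hAv x v hv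
    have hnode : ∀ y, (∀ i, y = .inr i → layer i < t + 1) →
        A.mulVec v (pos y) = C.nodeValue x y := by
      rintro (i | i) hy
      · exact h₁ i
      · exact h₂ i (Nat.lt_succ_iff.1 (hy i rfl))
    rw [← Matrix.mulVec_mulVec]
    refine ⟨fun i => ?_, fun j hj => ?_⟩
    · rw [sparse_mulVec]
      simp only [a, b, l, r, hpos.extend_apply, Sum.elim_inl, h₁, one_mul, zero_mul, add_zero]
    · rw [sparse_mulVec]
      simp only [a, b, l, r, hpos.extend_apply, Sum.elim_inr]
      by_cases hj' : layer j = t + 1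
      · simp only [if_pos hj']
        rw [C.gateValue_eq, hnode, hnode]
        · exact fun i hi => hj' ▸ (hl j).2.2.2 i hi
        · exact fun i hi => hj' ▸ (hl j).2.2.1 i hi
      · simp only [if_neg hj', one_mul, zero_mul, add_zero]
        exact h₂ j (by omega)

theorem LinearCircuit.exists_corner (C : LinearCircuit 𝕜 n n) {M : Matrix (Fin n) (Fin n) 𝕜}
    (hC : C.Computes M) (hs : C.size ≤ 2 ^ k) (hn : n ≤ 2 ^ k) :
    ∃ A : Matrix (Fin (2 ^ k)) (Fin (2 ^ k)) 𝕜,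
      IsOBBPow (5 * (C.depth + 2)) (ofBlocks A 0 0 0) ∧
        M = A.submatrix (Fin.castLE hn) (Fin.castLE hn) := by
  obtain ⟨layer, hl⟩ := C.exists_isLayering_depth
  let pos : Fin n ⊕ Fin C.gates → Fin (2 ^ k) := fun x => Fin.castLE hs (finSumFinEquiv x)
  have hpos : Function.Injective pos :=
    (Fin.castLE_injective hs).comp finSumFinEquiv.injective
  have hinl : ∀ i, pos (.inl i) = Fin.castLE hn i := fun i => by
    ext
    simp only [pos, finSumFinEquiv_apply_left]
    rfl
  obtain ⟨A, hA, hAv⟩ := C.exists_isOBBPow_layers hl pos hpos C.depth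
  -- One more sparse map moves the outputs to the first `n` cells, whence `depth + 2` blocks of 5
  -- factors.
  let o : Fin (2 ^ k) → Fin (2 ^ k) :=
    Function.extend (Fin.castLE hn) (fun i => pos (C.out i)) id
  refine ⟨_, by
    have := (isOBBPow_ofBlocks_sparse (𝕜 := 𝕜) (fun _ => 1) (fun _ => 0) o id).ofBlocks_mul_corner
      hA
    rwa [show 5 * (C.depth + 2) = 5 + 5 * (C.depth + 1) by ring], ?_⟩
  ext i j
  obtain ⟨h₁, h₂⟩ := hAv (Pi.single j 1) (Pi.single (Fin.castLE hn j) 1) (fun i => by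
    rw [hinl, Pi.single_apply, Pi.single_apply]
    simp only [(Fin.castLE_injective hn).eq_iff])
  have hnode : ∀ y, A.mulVec (Pi.single (Fin.castLE hn j) 1) (pos y) =
      C.nodeValue (Pi.single j 1) y := by
    rintro (i | i)
    · exact h₁ i
    · exact h₂ i (hl i).2.1
  have hM : M i j = M.mulVec (Pi.single j 1) i := by
    rw [Matrix.mulVec_single_one]; rfl
  rw [hM, ← hC, ← hnode, Matrix.submatrix_apply]
  have hcol : ∀ B : Matrix (Fin (2 ^ k)) (Fin (2 ^ k)) 𝕜,
      B (Fin.castLE hn i) (Fin.castLE hn j) =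
        B.mulVec (Pi.single (Fin.castLE hn j) 1) (Fin.castLE hn i) := fun B => by
    rw [Matrix.mulVec_single_one]; rfl
  refine Eq.trans ?_ (hcol _).symm
  rw [← Matrix.mulVec_mulVec, sparse_mulVec, one_mul, zero_mul, add_zero]
  simp only [o, (Fin.castLE_injective hn).extend_apply]

end Circuit

end Kaleidoscope

theorem mainTheorem7 :
    ∃ Cw Ce : ℕ, ∀ (𝕜 : Type*) [RCLike 𝕜] (n s d : ℕ) (_hn : 1 ≤ n)
      (M : Matrix (Fin n) (Fin n) 𝕜) (C : Kaleidoscope.LinearCircuit 𝕜 n n),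
      C.Computes M → C.size = s → C.depth = d →
        ∃ (w : ℕ) (e : ℚ), w ≤ Cw * max d 1 ∧ e ≤ (Ce : ℚ) * ((s : ℚ) / (n : ℚ)) ∧
          Kaleidoscope.InOBBHierarchy w e M := by
  -- `5 * (d + 2) ≤ 15 * max d 1`. Rounding `s` up to a power of two costs a factor of at most 2,
  -- and the scratch half another 2.
  refine ⟨15, 4, ?_⟩
  rintro 𝕜 _ n s d hn M C hC rfl rfl
  have hns : n ≤ C.size := Nat.le_add_right n C.gates
  have hlt : C.size ≤ 2 ^ Nat.clog 2 C.size := Nat.le_pow_clog one_lt_two _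
  have hle : 2 ^ Nat.clog 2 C.size ≤ 2 * C.size := by
    rcases Nat.lt_or_ge 1 C.size with h | h
    · have h1 := Nat.pow_pred_clog_lt_self one_lt_two h
      have h2 : 0 < Nat.clog 2 C.size := Nat.clog_pos one_lt_two h
      obtain ⟨c, hc⟩ := Nat.exists_eq_succ_of_ne_zero h2.ne'
      rw [hc] at h1 ⊢
      rw [Nat.pow_succ]
      simp only [Nat.pred_succ] at h1
      omega
    · rw [Nat.clog_of_right_le_one h]
      omega
  generalize Nat.clog 2 C.size = k at hlt hle
  have hnk : n ≤ 2 ^ k := hns.trans hlt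
  obtain ⟨A, hA, hM⟩ := C.exists_corner hC hlt hnk
  have hn0 : (0 : ℚ) < n := by exact_mod_cast hn
  refine ⟨5 * (C.depth + 2), 2 ^ (k + 1) / n, ?_, ?_, k + 1,
    hnk.trans (Nat.pow_le_pow_right two_pos k.le_succ), _, ?_, hA, ?_⟩
  · have h1 := le_max_left C.depth 1
    have h2 := le_max_right C.depth 1
    omega
  · rw [← mul_div_assoc]
    refine div_le_div_of_nonneg_right ?_ hn0.le
    have : (2 : ℚ) ^ k ≤ 2 * C.size := by exact_mod_cast hle
    rw [pow_succ]
    push_cast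
    linarith
  · exact div_mul_cancel₀ _ hn0.ne'
  · have hidx : ∀ i : Fin n, Fin.castLE (hnk.trans (Nat.pow_le_pow_right two_pos k.le_succ)) i =
        Kaleidoscope.halves k (.inl (Fin.castLE hnk i)) := fun i => by
      ext
      rw [Kaleidoscope.halves_inl_val]
      rfl
    ext i j
    rw [hM, Matrix.submatrix_apply, Matrix.submatrix_apply, hidx, hidx,
      Kaleidoscope.ofBlocks_apply]
    rfl
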